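/- Let $\Omega$ be a set and let $\varphi(t,\omega)$, $f(t,\omega)$ be real-valued functions on $\mathbb R\times\Omega$ that are infinitely differentiable in $t$ for every $\omega\in\Omega$. Suppose that for every $\omega$ there is an interval $[a(\omega),b(\omega)]\subset\mathbb R$ that contains the support of $t\mapsto\varphi(t,\omega)$. For real $k$ put $$I(k,\omega)=\int_{-\infty}^{\infty}\varphi(t,\omega)\,e^{ikf(t,\omega)}\,dt .$$ A point $(t,\omega)$ is called stationary if $\frac{d}{dt}f(t,\omega)=0$; it has order $m$ if $m$ is the first positive integer with $f^{(m)}_t(t,\omega):=(\frac{d}{dt})^m f(t,\omega)\neq0$. Let $C_m=2\int_0^\infty e^{-x^m}\,dx$. Then for every fixed $\omega\in\Omega$ the following holds. (i) If there is no stationary point $(t,\omega)$ with $t\in[a(\omega),b(\omega)]$, then $I(k,\omega)=O(k^{-\infty})$ as $k\to+\infty$, that is, $I(k,\omega)=O(k^{-n})$ for every $n\in\mathbb N$. (ii) If the set of all $t\in[a(\omega),b(\omega)]$ for which $(t,\omega)$ is stationary is a non-empty finite set $\{t_j\}$ and each $(t_j,\omega)$ has a finite order $m_j$, then, as $k\to+\infty$,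 $$I(k,\omega)=\sum_{m_j\text{ even}}\left(\varphi(t_j,\omega)\,C_{m_j}\left(\frac{m_j!}{k\,|f^{(m_j)}_t(t_j,\omega)|}\right)^{1/m_j}e^{\operatorname{sign}(f^{(m_j)}_t(t_j,\omega))\,i\pi/(2m_j)}\,e^{ikf(t_j,\omega)}+O\big(k^{-2/m_j}\big)\right)$$ $$\qquad+\sum_{m_j\text{ odd}}\left(\varphi(t_j,\omega)\,C_{m_j}\left(\frac{m_j!}{k\,|f^{(m_j)}_t(t_j,\omega)|}\right)^{1/m_j}\cos\!\left(\frac{\pi}{2m_j}\right)e^{ikf(t_j,\omega)}+O\big(k^{-2/m_j}\big)\right).$$ The constants in the $O$-terms may depend on $\varphi$, $f$ and $\omega$ (and on $n$ in (i)). -/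

import Mathlib

open Set Filter Asymptotics

noncomputable section

namespace StationaryPhase

variable {Ω : Type*}

/-- The high-frequency integral `I(k, ω) = ∫ φ(t, ω) exp(i k f(t, ω)) dt`. -/
def highFreqIntegral (φ f : ℝ → Ω → ℝ) (k : ℝ) (ω : Ω) : ℂ :=
  ∫ t : ℝ, (φ t ω : ℂ) * Complex.exp (Complex.I * k * f t ω)

/-- `n`-th derivative with respect to `t`, at the point `(t, ω)`. -/
def tDeriv (n : ℕ) (f : ℝ → Ω → ℝ) (t : ℝ) (ω : Ω) : ℝ :=
  iteratedDeriv n (fun s => f s ω) t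

/-- The set of stationary phase points of `f`. -/
def St (f : ℝ → Ω → ℝ) : Set (ℝ × Ω) :=
  {p | deriv (fun s => f s p.2) p.1 = 0}

/-- The set of stationary phase points of order `m`: `m` is the first positive integer such that
the `m`-th `t`-derivative of `f` does not vanish at the point. -/
def StOrder (f : ℝ → Ω → ℝ) (m : ℕ) : Set (ℝ × Ω) :=
  {p | p ∈ St f ∧ IsLeast {n : ℕ | 1 ≤ n ∧ tDeriv n f p.1 p.2 ≠ 0} m}

/-- The constant `C_m = 2 ∫_0^∞ exp(-x^m) dx`. -/
def C (m : ℕ) : ℝ := 2 * ∫ x in Ioi (0 : ℝ), Real.exp (-x ^ m)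

/-- The factor `(m! / (k |f^(m)(t, ω)|))^(1/m)`. -/
def scale (f : ℝ → Ω → ℝ) (ω : Ω) (m : ℕ) (t k : ℝ) : ℝ :=
  ((m.factorial : ℝ) / (k * |tDeriv m f t ω|)) ^ (1 / (m : ℝ))

/-- Leading contribution of a stationary phase point `(t, ω)` of even order `m`. -/
def evenTerm (φ f : ℝ → Ω → ℝ) (ω : Ω) (m : ℕ) (t k : ℝ) : ℂ :=
  (φ t ω : ℂ) * (C m : ℂ) * (scale f ω m t k : ℂ)
    * Complex.exp ((Real.sign (tDeriv m f t ω) : ℂ) * Complex.I * (Real.pi / (2 * m)))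
    * Complex.exp (Complex.I * k * f t ω)

/-- Leading contribution of a stationary phase point `(t, ω)` of odd order `m`. -/
def oddTerm (φ f : ℝ → Ω → ℝ) (ω : Ω) (m : ℕ) (t k : ℝ) : ℂ :=
  (φ t ω : ℂ) * (C m : ℂ) * (scale f ω m t k : ℂ)
    * (Real.cos (Real.pi / (2 * m)) : ℂ)
    * Complex.exp (Complex.I * k * f t ω)

end StationaryPhase

end

section

open MeasureTheory Topology intervalIntegral
open scoped ContDiff

/-! Only zeros of `f'` can spoil decay: elsewhere `exp (ikf)` is the derivative of itself divided by
`ikf'`, so each integration by parts gains a factor `1/k`. This gives (i), and in (ii) it lets a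
smooth cutoff isolate the stationary points one at a time (`exists_integral_eq_sum_stationaryTerm`).

Near a stationary point of order `m`, moved to the origin, write `f s - f 0 = s ^ m * H s` with `H 0
≠ 0` and let `σ` be the sign of `H 0`. For `s ≥ 0` small, `u = s * (σ H) ^ (1/m)` turns the phase
into `f 0 + σ u ^ m`. The amplitude splits as `c u' + s η p`, where `p = f' / s ^ (m-1)` does not
vanish near `0`. Substitution turns the first summand into the truncated Fresnel integral of `exp
(ikσ u ^ m)`, whose value is `Γ(1 + 1/m) (-ikσ) ^ (-1/m) + O(1/k)`. The second summand has an extra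
zero at the stationary point and is `O(k ^ (-2/m))` by a van der Corput argument
(`isBigO_integral_id_mul`).

The left side of the point is treated by reflection, which multiplies the `m`-th derivative by `(-1)
^ m`. For even `m` the two phase factors agree and double; for odd `m` they are conjugate and add up
to a cosine. -/

/-! ### Generalized Gaussian and Fresnel integrals -/

theorem exp_neg_mul_pow_integrableOn {m : ℕ} (hm : 2 ≤ m) (j : ℕ) {b : ℝ} (hb : 0 < b) :
    IntegrableOn (fun x : ℝ => x ^ j * Real.exp (-(b * x ^ m))) (Ioi 0) := by
  have h := integrableOn_rpow_mul_exp_neg_mul_rpow (p := (m : ℝ)) (s := (j : ℝ)) (b := b)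
    (by have : (0 : ℝ) ≤ j := by positivity
        linarith) (by exact_mod_cast (by omega : 1 ≤ m)) hb
  simpa using h

theorem norm_cexp_neg_mul_pow (z : ℂ) (x : ℝ) (m : ℕ) :
    ‖Complex.exp (-(z * (x : ℂ) ^ m))‖ = Real.exp (-(z.re * x ^ m)) := by
  rw [Complex.norm_exp, ← Complex.ofReal_pow, Complex.neg_re, Complex.re_mul_ofReal]

theorem cexp_neg_mul_pow_integrableOn {m : ℕ} (hm : 2 ≤ m) {z : ℂ} (hz : 0 < z.re) :
    IntegrableOn (fun x : ℝ => Complex.exp (-(z * (x : ℂ) ^ m))) (Ioi 0) := by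
  have h := exp_neg_mul_pow_integrableOn hm 0 hz
  simp only [pow_zero, one_mul] at h
  refine Integrable.mono' h (by fun_prop) (ae_of_all _ fun x => ?_)
  rw [norm_cexp_neg_mul_pow]

/-- Holomorphy in the parameter allows the Gamma formula to be continued from the positive reals to
the right half plane. The derivative is dominated on `Re w > Re z / 2`. -/
theorem differentiableAt_integral_cexp_neg_mul_pow {m : ℕ} (hm : 2 ≤ m) {z : ℂ} (hz : 0 < z.re) :
    DifferentiableAt ℂ (fun w : ℂ => ∫ x in Ioi (0 : ℝ), Complex.exp (-(w * (x : ℂ) ^ m))) z := by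
  have hs : {w : ℂ | z.re / 2 < w.re} ∈ 𝓝 z :=
    (isOpen_lt continuous_const Complex.continuous_re).mem_nhds (by simp [hz])
  refine (hasDerivAt_integral_of_dominated_loc_of_deriv_le (μ := volume.restrict (Ioi 0))
    (F := fun w (x : ℝ) => Complex.exp (-(w * (x : ℂ) ^ m)))
    (F' := fun w (x : ℝ) => Complex.exp (-(w * (x : ℂ) ^ m)) * (-(1 * (x : ℂ) ^ m)))
    (bound := fun x => x ^ m * Real.exp (-(z.re / 2 * x ^ m))) hs
    (Eventually.of_forall fun w => by fun_prop) (cexp_neg_mul_pow_integrableOn hm hz)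
    (by fun_prop) ?_ (exp_neg_mul_pow_integrableOn hm m (half_pos hz)) ?_).2.differentiableAt
  · refine (ae_restrict_mem measurableSet_Ioi).mono fun x hx w hw => ?_
    have hx : 0 < x := hx
    have hw : z.re / 2 < w.re := hw
    rw [norm_mul, norm_cexp_neg_mul_pow, mul_comm]
    have : ‖(-(1 * (x : ℂ) ^ m))‖ = x ^ m := by simp [abs_of_pos hx]
    rw [this]
    gcongr
  · refine ae_of_all _ fun x w _ => ?_
    exact ((((hasDerivAt_id w).mul_const _).neg).cexp)

/-- The generalized Gaussian integral `∫₀^∞ exp(-z xᵐ) dx` on the right half plane. -/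
theorem integral_cexp_neg_mul_pow {m : ℕ} (hm : 2 ≤ m) {z : ℂ} (hz : 0 < z.re) :
    ∫ x in Ioi (0 : ℝ), Complex.exp (-(z * (x : ℂ) ^ m)) =
      Real.Gamma (1 / m + 1) * z ^ (-(1 / (m : ℂ))) := by
  have hm0 : (0 : ℝ) < m := by exact_mod_cast (by omega : 0 < m)
  set U : Set ℂ := {w | 0 < w.re} with hU
  have hUo : IsOpen U := isOpen_lt continuous_const Complex.continuous_re
  have hUc : IsPreconnected U := (convex_halfSpace_re_gt 0).isPreconnected
  have h1 : AnalyticOnNhd ℂ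
      (fun w : ℂ => ∫ x in Ioi (0 : ℝ), Complex.exp (-(w * (x : ℂ) ^ m))) U :=
    DifferentiableOn.analyticOnNhd
      (fun w hw => (differentiableAt_integral_cexp_neg_mul_pow hm hw).differentiableWithinAt) hUo
  have h2 : AnalyticOnNhd ℂ
      (fun w : ℂ => (Real.Gamma (1 / m + 1) : ℂ) * w ^ (-(1 / (m : ℂ)))) U := by
    refine DifferentiableOn.analyticOnNhd (fun w hw => ?_) hUo
    refine (DifferentiableAt.const_mul ?_ _).differentiableWithinAt
    exact differentiableAt_id.cpow_const (Or.inl hw)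
  have hreal : ∀ b : ℝ, 0 < b → ∫ x in Ioi (0 : ℝ), Complex.exp (-((b : ℂ) * (x : ℂ) ^ m)) =
      Real.Gamma (1 / m + 1) * (b : ℂ) ^ (-(1 / (m : ℂ))) := by
    intro b hb
    have h := integral_exp_neg_mul_rpow hm0 hb
    have e : (fun x : ℝ => Complex.exp (-((b : ℂ) * (x : ℂ) ^ m))) =
        fun x : ℝ => ((Real.exp (-b * x ^ (m : ℝ)) : ℝ) : ℂ) := by
      funext x
      push_cast [Real.rpow_natCast]
      ring_nf
    rw [e, integral_complex_ofReal, h]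
    push_cast
    rw [Complex.ofReal_cpow hb.le, mul_comm]
    push_cast
    congr 2
    ring
  -- Identity theorem: the two sides agree at the real points `1 + 1/(n+1)`, which accumulate at
  -- `1`.
  refine h1.eqOn_of_preconnected_of_frequently_eq h2 hUc (z₀ := 1) (by simp [hU]) ?_ hz
  have ht : Tendsto (fun n : ℕ => (((1 : ℝ) + 1 / ((n : ℝ) + 1) : ℝ) : ℂ)) atTop (𝓝[≠] 1) := by
    refine tendsto_nhdsWithin_iff.mpr ⟨?_, Eventually.of_forall fun n => ?_⟩
    · have := (tendsto_one_div_add_atTop_nhds_zero_nat (𝕜 := ℝ)).const_add 1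
      rw [add_zero] at this
      exact (Complex.continuous_ofReal.tendsto' 1 1 (by simp)).comp this
    · have : (0 : ℝ) < 1 / ((n : ℝ) + 1) := by positivity
      intro h
      have h' : (1 : ℝ) + 1 / ((n : ℝ) + 1) = 1 := Complex.ofReal_injective (by simpa using h)
      linarith
  refine ht.frequently (Frequently.of_forall fun n => ?_)
  exact hreal _ (by positivity)

/-- Uniform tail bound for the generalized Fresnel integral. -/
theorem norm_integral_cexp_neg_mul_pow_le {m : ℕ} (hm : 2 ≤ m) {z : ℂ} (hz : 0 ≤ z.re)
    (hz0 : z ≠ 0) {U V : ℝ} (hU : 0 < U) (hUV : U ≤ V) :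
    ‖∫ x in U..V, Complex.exp (-(z * (x : ℂ) ^ m))‖ ≤ 3 / (‖z‖ * U ^ (m - 1)) := by
  obtain ⟨n, rfl⟩ : ∃ n, m = n + 1 := ⟨m - 1, by omega⟩
  have hn : 1 ≤ n := by omega
  simp only [Nat.add_sub_cancel]
  have hpos : ∀ x ∈ uIcc U V, 0 < x := fun x hx => by
    rw [uIcc_of_le hUV] at hx; exact hU.trans_le hx.1
  have hzn : 0 < ‖z‖ := norm_pos_iff.mpr hz0
  have hn1 : ((n : ℂ) + 1) ≠ 0 := by exact_mod_cast (Nat.succ_ne_zero n)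
  -- Since `E' = -z (n+1) x ^ n E`, the integral of `E` is, up to the factor `-z (n+1)`, that of `A
  -- E'`. After integrating by parts, the boundary terms and the total variation of the decreasing
  -- `A` are each at most `A U`, whence the constant `3`.
  set A : ℝ → ℝ := fun x => (x ^ n)⁻¹
  set A' : ℝ → ℝ := fun x => -(n * x ^ (n - 1)) / (x ^ n) ^ 2
  have hA : ∀ x ∈ uIcc U V, HasDerivAt A (A' x) x := fun x hx =>
    (hasDerivAt_pow n x).fun_inv (pow_pos (hpos x hx) n).ne'
  have hA'c : ContinuousOn A' (uIcc U V) := by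
    refine ContinuousOn.div (by fun_prop) (by fun_prop) fun x hx => ?_
    have := hpos x hx
    positivity
  set E : ℝ → ℂ := fun x => Complex.exp (-(z * (x : ℂ) ^ (n + 1)))
  have hE : ∀ x : ℝ, HasDerivAt E (E x * (-(z * ((n + 1 : ℕ) * (x : ℂ) ^ n)))) x := fun x =>
    ((((hasDerivAt_pow (n + 1) (x : ℂ)).comp_ofReal).const_mul z).neg.cexp)
  have hEn : ∀ x ∈ uIcc U V, ‖E x‖ ≤ 1 := fun x hx => by
    have := hpos x hx
    rw [norm_cexp_neg_mul_pow, Real.exp_le_one_iff]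
    have : 0 ≤ z.re * x ^ (n + 1) := by positivity
    linarith
  have hEc : Continuous E := by fun_prop
  have key := integral_mul_deriv_eq_deriv_mul (u := fun x => (A x : ℂ)) (v := E)
    (fun x hx => (hA x hx).ofReal_comp) (fun x _ => hE x)
    (ContinuousOn.intervalIntegrable (by fun_prop))
    (Continuous.intervalIntegrable (by fun_prop) _ _)
  have e1 : ∫ x in U..V, (A x : ℂ) * (E x * (-(z * ((n + 1 : ℕ) * (x : ℂ) ^ n)))) =
      -(z * (n + 1)) * ∫ x in U..V, E x := by
    rw [← intervalIntegral.integral_const_mul]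
    refine integral_congr fun x hx => ?_
    have : (x : ℂ) ≠ 0 := by exact_mod_cast (hpos x hx).ne'
    simp only [A]
    push_cast
    field_simp
  rw [e1] at key
  have hbA : ∫ x in U..V, -A' x = A U - A V := by
    rw [intervalIntegral.integral_neg, integral_eq_sub_of_hasDerivAt hA hA'c.intervalIntegrable]
    ring
  have hb : ‖∫ x in U..V, (A' x : ℂ) * E x‖ ≤ A U - A V := by
    rw [← hbA]
    refine norm_integral_le_of_norm_le hUV (ae_of_all _ fun x hx => ?_)
      (hA'c.neg.intervalIntegrable)
    have hx' : x ∈ uIcc U V := by rw [uIcc_of_le hUV]; exact ⟨hx.1.le, hx.2⟩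
    have hxp := hpos x hx'
    have hA'neg : A' x ≤ 0 := by
      simp only [A']
      rw [neg_div]
      have : 0 ≤ n * x ^ (n - 1) / (x ^ n) ^ 2 := by positivity
      linarith
    rw [norm_mul, Complex.norm_real, Real.norm_eq_abs, abs_of_nonpos hA'neg]
    exact mul_le_of_le_one_right (by linarith) (hEn x hx')
  have hAU : 0 < A U := by simp only [A]; positivity
  have hV : 0 < V := hU.trans_le hUV
  have hAV : 0 < A V := by simp only [A]; positivity
  have hAVU : A V ≤ A U := by
    simp only [A]
    gcongr
  have hlhs : ‖(-(z * (n + 1)) : ℂ)‖ = ‖z‖ * (n + 1) := by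
    rw [norm_neg, norm_mul]
    congr 1
    exact_mod_cast Complex.norm_natCast (n + 1)
  have hfin : ‖z‖ * (n + 1) * ‖∫ x in U..V, E x‖ ≤ 3 * A U := by
    rw [← hlhs, ← norm_mul, key]
    calc _ ≤ ‖(A V : ℂ) * E V‖ + ‖(A U : ℂ) * E U‖ + ‖∫ x in U..V, (A' x : ℂ) * E x‖ :=
          (norm_sub_le _ _).trans (by gcongr; exact norm_sub_le _ _)
      _ ≤ A V * 1 + A U * 1 + (A U - A V) := by
          rw [norm_mul, norm_mul, Complex.norm_real, Complex.norm_real, Real.norm_eq_abs,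
            Real.norm_eq_abs, abs_of_pos hAU, abs_of_pos hAV]
          gcongr
          · exact hEn V right_mem_uIcc
          · exact hEn U left_mem_uIcc
      _ ≤ 3 * A U := by linarith
  have : ‖z‖ * ‖∫ x in U..V, E x‖ ≤ 3 * A U := by
    refine le_trans ?_ hfin
    have : 0 ≤ ‖∫ x in U..V, E x‖ := norm_nonneg _
    have h0 : (0 : ℝ) ≤ n := by positivity
    nlinarith [mul_nonneg (mul_nonneg hzn.le h0) this]
  rw [show (3 : ℝ) / (‖z‖ * U ^ n) = 3 * A U / ‖z‖ by simp only [A]; field_simp, le_div_iff₀ hzn]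
  linarith

/-- The truncated Fresnel integral `∫₀^U exp(± i k xᵐ) dx` up to `O(1/k)`. -/
theorem norm_fresnel_sub_le {m : ℕ} (hm : 2 ≤ m) {U : ℝ} (hU : 0 < U) {c : ℝ} (hc : c ≠ 0) :
    ‖(∫ x in (0 : ℝ)..U, Complex.exp (Complex.I * c * (x : ℂ) ^ m)) -
      Real.Gamma (1 / m + 1) * (-(Complex.I * c)) ^ (-(1 / (m : ℂ)))‖ ≤
      3 / (|c| * U ^ (m - 1)) := by
  -- The oscillatory case is a limit from inside the right half plane, where the integral converges
  -- absolutely. The tail bound survives the limit because `‖w n‖ ≥ |c|`.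
  set w : ℕ → ℂ := fun n => ((1 / ((n : ℝ) + 1) : ℝ) : ℂ) - Complex.I * c
  have hw : Tendsto w atTop (𝓝 (-(Complex.I * c))) := by
    have := (Complex.continuous_ofReal.tendsto' 0 0 (by simp)).comp
      (tendsto_one_div_add_atTop_nhds_zero_nat (𝕜 := ℝ))
    simpa [w] using this.sub_const (Complex.I * c)
  have hwre : ∀ n, (w n).re = 1 / ((n : ℝ) + 1) := fun n => by
    simp only [w, Complex.sub_re, Complex.ofReal_re, Complex.I_mul_re, Complex.ofReal_im, neg_zero,
      sub_zero]
  have hwpos : ∀ n, 0 < (w n).re := fun n => by rw [hwre]; positivity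
  have hwn : ∀ n, |c| ≤ ‖w n‖ := fun n => by
    have := Complex.abs_im_le_norm (w n)
    simpa [w] using this
  have hbound : ∀ n, ‖(∫ x in (0 : ℝ)..U, Complex.exp (-(w n * (x : ℂ) ^ m))) -
      Real.Gamma (1 / m + 1) * (w n) ^ (-(1 / (m : ℂ)))‖ ≤ 3 / (|c| * U ^ (m - 1)) := by
    intro n
    rw [← integral_cexp_neg_mul_pow hm (hwpos n), norm_sub_rev]
    have hint := cexp_neg_mul_pow_integrableOn hm (hwpos n)
    have ht := (intervalIntegral_tendsto_integral_Ioi 0 hint tendsto_id).sub_const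
      (∫ x in (0 : ℝ)..U, Complex.exp (-(w n * (x : ℂ) ^ m)))
    refine le_of_tendsto ht.norm ?_
    filter_upwards [eventually_ge_atTop U] with V hV
    rw [id, integral_interval_sub_left (Continuous.intervalIntegrable (by fun_prop) _ _)
      (Continuous.intervalIntegrable (by fun_prop) _ _)]
    refine (norm_integral_cexp_neg_mul_pow_le hm (hwpos n).le ?_ hU hV).trans ?_
    · intro h
      have := hwpos n
      simp [h] at this
    · have := abs_pos.mpr hc
      gcongr
      exact hwn n
  refine le_of_tendsto (x := atTop) (Tendsto.norm (Tendsto.sub ?_ ?_)) (Eventually.of_forall hbound)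
  · have hcont : Continuous fun z : ℂ => ∫ x in (0 : ℝ)..U, Complex.exp (-(z * (x : ℂ) ^ m)) :=
      continuous_parametric_intervalIntegral_of_continuous' (by fun_prop) _ _
    have := (hcont.tendsto (-(Complex.I * c))).comp hw
    simpa [Function.comp_def] using this
  -- The limit `-ic` has nonzero imaginary part, so it avoids the branch cut.
  · refine Tendsto.const_mul _ ((continuousAt_cpow_const (b := -(1 / (m : ℂ))) ?_).tendsto.comp hw)
    right
    simpa using hc

/-! ### Smooth factorization at a zero -/

/-- The weight `x ^ n` makes this family of integrals closed under differentiation in `s`, so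
smoothness follows by induction on the order. -/
theorem hasDerivAt_integral_pow_mul_comp_mul {F : ℝ → ℝ} (hF : ContDiff ℝ ∞ F) (n : ℕ) (s : ℝ) :
    HasDerivAt (fun s => ∫ x in (0 : ℝ)..1, x ^ n * F (s * x))
      (∫ x in (0 : ℝ)..1, x ^ (n + 1) * deriv F (s * x)) s := by
  have hFc : Continuous F := hF.continuous
  have hF' : Continuous (deriv F) := hF.continuous_deriv (by simp)
  obtain ⟨M, hM⟩ := (isCompact_Icc (a := -(|s| + 1)) (b := |s| + 1)).exists_bound_of_continuousOn
    hF'.continuousOn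
  refine (intervalIntegral.hasDerivAt_integral_of_dominated_loc_of_deriv_le
    (F' := fun s x => x ^ (n + 1) * deriv F (s * x)) (bound := fun _ => M)
    (Metric.ball_mem_nhds s one_pos) (Eventually.of_forall fun t => ?_)
    (Continuous.intervalIntegrable (by fun_prop) _ _) ?_ ?_ (by simp) ?_).2
  · exact Continuous.aestronglyMeasurable (by fun_prop)
  · exact Continuous.aestronglyMeasurable (by fun_prop)
  · refine ae_of_all _ fun x hx t ht => ?_
    rw [uIoc_of_le zero_le_one] at hx
    have hx0 := hx.1
    have ht' : |t| ≤ |s| + 1 := by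
      have h1 : |t - s| < 1 := by simpa [Real.dist_eq] using ht
      have := abs_sub_abs_le_abs_sub t s
      linarith
    have htx : |t * x| ≤ |s| + 1 := by
      rw [abs_mul, abs_of_pos hx0]
      exact (mul_le_of_le_one_right (abs_nonneg _) hx.2).trans ht'
    have h2 := hM (t * x) (abs_le.mp htx)
    rw [norm_mul, Real.norm_of_nonneg (pow_nonneg hx0.le _)]
    exact (mul_le_of_le_one_left (norm_nonneg _) (pow_le_one₀ hx0.le hx.2)).trans h2
  · refine ae_of_all _ fun x _ t _ => ?_
    have h1 : HasDerivAt F (deriv F (t * x)) (t * x) :=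
      (hF.differentiable (by simp) _).hasDerivAt
    have h2 : HasDerivAt (fun t => t * x) x t := by simpa using (hasDerivAt_id t).mul_const x
    have h3 := (h1.comp t h2).const_mul (x ^ n)
    rwa [show x ^ n * (deriv F (t * x) * x) = x ^ (n + 1) * deriv F (t * x) by ring] at h3

theorem contDiff_integral_pow_mul_comp_mul {F : ℝ → ℝ} (hF : ContDiff ℝ ∞ F) (n : ℕ) :
    ContDiff ℝ ∞ (fun s => ∫ x in (0 : ℝ)..1, x ^ n * F (s * x)) := by
  rw [contDiff_infty]
  intro N
  induction N generalizing F n with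
  | zero =>
    exact contDiff_zero.mpr (continuous_iff_continuousAt.mpr fun s =>
      (hasDerivAt_integral_pow_mul_comp_mul hF n s).continuousAt)
  | succ N ih =>
    push_cast
    refine contDiff_succ_iff_deriv.mpr
      ⟨fun s => (hasDerivAt_integral_pow_mul_comp_mul hF n s).differentiableAt, by simp, ?_⟩
    have : deriv (fun s => ∫ x in (0 : ℝ)..1, x ^ n * F (s * x)) =
        fun s => ∫ x in (0 : ℝ)..1, x ^ (n + 1) * deriv F (s * x) :=
      funext fun s => (hasDerivAt_integral_pow_mul_comp_mul hF n s).deriv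
    rw [this]
    exact ih (contDiff_infty_iff_deriv.mp hF).2 (n + 1)

/-- Hadamard's lemma in one variable. -/
theorem exists_contDiff_eq_id_mul {F : ℝ → ℝ} (hF : ContDiff ℝ ∞ F) (h0 : F 0 = 0) :
    ∃ h : ℝ → ℝ, ContDiff ℝ ∞ h ∧ ∀ s, F s = s * h s := by
  have hF' : ContDiff ℝ ∞ (deriv F) := (contDiff_infty_iff_deriv.mp hF).2
  refine ⟨_, contDiff_integral_pow_mul_comp_mul hF' 0, fun s => ?_⟩
  have hd : ∀ x ∈ uIcc (0 : ℝ) 1, HasDerivAt (fun x => F (s * x)) (deriv F (s * x) * s) x := by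
    intro x _
    have h2 : HasDerivAt (fun x => s * x) s x := by simpa using (hasDerivAt_id x).const_mul s
    exact (hF.differentiable (by simp) _).hasDerivAt.comp x h2
  have := integral_eq_sub_of_hasDerivAt hd
    (Continuous.intervalIntegrable (by have := hF'.continuous; fun_prop) _ _)
  simp only [mul_one, mul_zero, h0, sub_zero] at this
  rw [← this, intervalIntegral.integral_mul_const, mul_comm]
  simp

theorem iteratedDeriv_succ_id_mul {h : ℝ → ℝ} (hh : ContDiff ℝ ∞ h) (n : ℕ) (s : ℝ) :
    iteratedDeriv (n + 1) (fun s => s * h s) s =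
      s * iteratedDeriv (n + 1) h s + (n + 1) * iteratedDeriv n h s := by
  have hd : ∀ j s, HasDerivAt (iteratedDeriv j h) (iteratedDeriv (j + 1) h s) s := fun j s => by
    rw [iteratedDeriv_succ]
    exact ((hh.differentiable_iteratedDeriv j (by exact_mod_cast WithTop.coe_lt_top _)) s).hasDerivAt
  induction n generalizing s with
  | zero =>
    rw [iteratedDeriv_one]
    have := ((hasDerivAt_id s).mul (hd 0 s)).deriv
    simp only [iteratedDeriv_zero] at this
    refine this.trans ?_
    simp [add_comm]
  | succ n ih =>
    rw [iteratedDeriv_succ, funext ih]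
    have := (((hasDerivAt_id s).mul (hd (n + 1) s)).add ((hd n s).const_mul ((n : ℝ) + 1))).deriv
    refine this.trans ?_
    simp
    ring

/-- Smooth factorization at a zero of order at least `m`. -/
theorem exists_contDiff_eq_pow_mul (m : ℕ) {F : ℝ → ℝ} (hF : ContDiff ℝ ∞ F)
    (h0 : ∀ j < m, iteratedDeriv j F 0 = 0) :
    ∃ H : ℝ → ℝ, ContDiff ℝ ∞ H ∧ (∀ s, F s = s ^ m * H s) ∧
      iteratedDeriv m F 0 = m.factorial * H 0 := by
  induction m generalizing F with
  | zero => exact ⟨F, hF, by simp, by simp⟩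
  | succ m ih =>
    obtain ⟨h, hh, hFh⟩ := exists_contDiff_eq_id_mul hF (by simpa using h0 0 (by omega))
    have hder : ∀ j, iteratedDeriv (j + 1) F 0 = (j + 1) * iteratedDeriv j h 0 := fun j => by
      rw [funext hFh, iteratedDeriv_succ_id_mul hh]
      simp
    obtain ⟨H, hH, hhH, hm⟩ := ih hh fun j hj => by
      have := (hder j).symm.trans (h0 (j + 1) (by omega))
      have h1 : (j : ℝ) + 1 ≠ 0 := by positivity
      simpa [h1] using this
    refine ⟨H, hH, fun s => by rw [hFh, hhH]; ring, ?_⟩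
    rw [hder, hm, Nat.factorial_succ]
    push_cast
    ring

/-! ### Non-stationary phase -/

/-- Meant for quotients whose denominator may vanish, but only away from the support of the
numerator. -/
theorem contDiff_of_contDiffAt_tsupport {G : ℝ → ℝ} (h : ∀ t ∈ tsupport G, ContDiffAt ℝ ∞ G t) :
    ContDiff ℝ ∞ G := by
  refine contDiff_iff_contDiffAt.mpr fun t => ?_
  by_cases ht : t ∈ tsupport G
  · exact h t ht
  · exact contDiffAt_const.congr_of_eventuallyEq (notMem_tsupport_iff_eventuallyEq.mp ht)

/-- Non-stationary phase: the integral decays faster than any power. -/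
theorem isBigO_integral_mul_cexp_of_deriv_ne_zero {f : ℝ → ℝ} (hf : ContDiff ℝ ∞ f) (n : ℕ)
    {g : ℝ → ℝ} (hg : ContDiff ℝ ∞ g) (hgc : HasCompactSupport g)
    (hne : ∀ t ∈ tsupport g, deriv f t ≠ 0) :
    (fun k : ℝ => ∫ t, (g t : ℂ) * Complex.exp (Complex.I * k * f t)) =O[atTop]
      fun k : ℝ => 1 / k ^ n := by
  have hfc := hf.continuous
  have hf' : ContDiff ℝ ∞ (deriv f) := (contDiff_infty_iff_deriv.mp hf).2
  induction n generalizing g with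
  | zero =>
    refine IsBigO.of_bound (∫ t, ‖g t‖) (Eventually.of_forall fun k => ?_)
    simp only [pow_zero, div_one, norm_one, mul_one]
    refine (MeasureTheory.norm_integral_le_integral_norm _).trans (le_of_eq ?_)
    congr 1
    funext t
    rw [norm_mul, mul_assoc, mul_comm Complex.I, ← Complex.ofReal_mul,
      Complex.norm_exp_ofReal_mul_I, mul_one, Complex.norm_real]
  | succ n ih =>
    -- Integration by parts replaces `g` by `G'`, whose support is no larger, at the gain of a
    -- factor `1/k`.
    set G : ℝ → ℝ := fun t => g t / deriv f t
    have hGsub : Function.support G ⊆ Function.support g := fun t ht h => ht (by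
      have : g t = 0 := h
      simp [G, this])
    have hGts : tsupport G ⊆ tsupport g := closure_mono hGsub
    have hG : ContDiff ℝ ∞ G := contDiff_of_contDiffAt_tsupport fun t ht =>
      hg.contDiffAt.div hf'.contDiffAt (hne t (hGts ht))
    have hGc : HasCompactSupport G := hgc.mono hGsub
    have hG' : ContDiff ℝ ∞ (deriv G) := (contDiff_infty_iff_deriv.mp hG).2
    have hG'c : HasCompactSupport (deriv G) := hGc.deriv
    have hG'ts : tsupport (deriv G) ⊆ tsupport g :=
      (closure_minimal (support_deriv_subset) isClosed_closure).trans hGts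
    have h := ih hG' hG'c fun t ht => hne t (hG'ts ht)
    have hval : ∀ k : ℝ, 0 < k → ∫ t, (g t : ℂ) * Complex.exp (Complex.I * k * f t) =
        (-(Complex.I * k)⁻¹) * ∫ t, ((deriv G t : ℝ) : ℂ) * Complex.exp (Complex.I * k * f t) := by
      intro k hk
      have hk0 : (k : ℂ) ≠ 0 := by exact_mod_cast hk.ne'
      set E : ℝ → ℂ := fun t => Complex.exp (Complex.I * k * f t)
      have hEc : Continuous E := by fun_prop
      have hE : ∀ t, HasDerivAt E (E t * (Complex.I * k * ((deriv f t : ℝ) : ℂ))) t := fun t => by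
        have h1 : HasDerivAt (fun t => (f t : ℂ)) ((deriv f t : ℝ) : ℂ) t :=
          (hf.differentiable (by simp) t).hasDerivAt.ofReal_comp
        exact (h1.const_mul (Complex.I * k)).cexp
      have hcint : ∀ {q : ℝ → ℝ} {e : ℝ → ℂ}, HasCompactSupport q → Continuous q → Continuous e →
          Integrable ((fun t => (q t : ℂ)) * e) := by
        intro q e hq hqc he
        have h1 : HasCompactSupport (fun t => (q t : ℂ)) :=
          HasCompactSupport.comp_left (g := Complex.ofReal) hq Complex.ofReal_zero
        exact Continuous.integrable_of_hasCompactSupport (by fun_prop) h1.mul_right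
      have hf'c := hf'.continuous
      have hi1 := hcint hGc hG.continuous
        (e := fun t => E t * (Complex.I * k * ((deriv f t : ℝ) : ℂ))) (by fun_prop)
      have hi2 := hcint hG'c hG'.continuous hEc
      have hi3 := hcint hGc hG.continuous hEc
      have := integral_mul_deriv_eq_deriv_mul_of_integrable
        (u := fun t => (G t : ℂ)) (v := E) (u' := fun t => ((deriv G t : ℝ) : ℂ))
        (fun t _ => (hG.differentiable (by simp) t).hasDerivAt.ofReal_comp)
        (fun t _ => hE t)
        hi1 hi2 hi3
      rw [neg_mul, ← mul_neg, ← this, ← MeasureTheory.integral_const_mul]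
      congr 1
      funext t
      -- Where `f'` vanishes so does `g`, and both integrands are zero.
      by_cases ht : deriv f t = 0
      · have : g t = 0 := by
          by_contra h0
          exact hne t (subset_closure h0) ht
        simp [this, ht]
      · have ht' : ((deriv f t : ℝ) : ℂ) ≠ 0 := by exact_mod_cast ht
        simp only [G, E]
        push_cast
        field_simp
    have hinv : (fun k : ℝ => -(Complex.I * (k : ℂ))⁻¹) =O[atTop] fun k : ℝ => 1 / k := by
      refine IsBigO.of_bound 1 (Eventually.of_forall fun k => ?_)
      simp
    refine ((hinv.mul h).congr' ?_ ?_)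
    · filter_upwards [eventually_gt_atTop 0] with k hk
      exact (hval k hk).symm
    · filter_upwards with k
      rw [pow_succ, ← one_div_mul_one_div, mul_comm]

/-! ### Amplitudes vanishing at the stationary point -/

theorem norm_ofReal_mul_cexp_I_mul (a k y : ℝ) :
    ‖(a : ℂ) * Complex.exp (Complex.I * k * y)‖ = |a| := by
  rw [norm_mul, mul_assoc, mul_comm Complex.I, ← Complex.ofReal_mul,
    Complex.norm_exp_ofReal_mul_I, mul_one, Complex.norm_real, Real.norm_eq_abs]

/-- Away from the origin `s η p = η s ^ (-j) f'`, so one integration by parts against `exp (ikf)`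
suffices. The boundary terms give `2N`, the variation of `s ^ (-j)` another `N`, and `η'` gives `N'
δ`, all times `κ ^ (-j)`. -/
theorem norm_integral_id_mul_le {j : ℕ} {f p η : ℝ → ℝ} (hf : ContDiff ℝ ∞ f)
    (hfp : ∀ s, deriv f s = s ^ (j + 1) * p s) (hη : ContDiff ℝ ∞ η)
    {κ δ N N' k : ℝ} (hκ : 0 < κ) (hκδ : κ ≤ δ) (hk : 0 < k)
    (hN : ∀ s ∈ Icc 0 δ, |η s| ≤ N) (hN' : ∀ s ∈ Icc 0 δ, |deriv η s| ≤ N') :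
    ‖∫ s in κ..δ, ((s * η s * p s : ℝ) : ℂ) * Complex.exp (Complex.I * k * f s)‖ ≤
      k⁻¹ * ((κ ^ j)⁻¹ * (3 * N + N' * δ)) := by
  have hpos : ∀ x ∈ uIcc κ δ, 0 < x := fun x hx => by
    rw [uIcc_of_le hκδ] at hx; exact hκ.trans_le hx.1
  have hmem : ∀ x ∈ uIcc κ δ, x ∈ Icc 0 δ := fun x hx => by
    rw [uIcc_of_le hκδ] at hx; exact ⟨hκ.le.trans hx.1, hx.2⟩
  have hk0 : (k : ℂ) ≠ 0 := by exact_mod_cast hk.ne'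
  have hf' : Continuous (deriv f) := hf.continuous_deriv (by simp)
  have hηc := hη.continuous
  have hη' : Continuous (deriv η) := hη.continuous_deriv (by simp)
  have hfc := hf.continuous
  have hN0 : 0 ≤ N := (abs_nonneg _).trans (hN κ (hmem κ left_mem_uIcc))
  have hN0' : 0 ≤ N' := (abs_nonneg _).trans (hN' κ (hmem κ left_mem_uIcc))
  set P : ℝ → ℝ := fun x => (x ^ j)⁻¹
  set P' : ℝ → ℝ := fun x => -(j * x ^ (j - 1)) / (x ^ j) ^ 2
  have hP : ∀ x ∈ uIcc κ δ, HasDerivAt P (P' x) x := fun x hx =>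
    (hasDerivAt_pow j x).fun_inv (pow_pos (hpos x hx) j).ne'
  have hP'c : ContinuousOn P' (uIcc κ δ) := by
    refine ContinuousOn.div (by fun_prop) (by fun_prop) fun x hx => ?_
    have := hpos x hx
    positivity
  have hPc : ContinuousOn P (uIcc κ δ) := fun x hx => (hP x hx).continuousAt.continuousWithinAt
  set A' : ℝ → ℝ := fun x => deriv η x * P x + η x * P' x
  have hA : ∀ x ∈ uIcc κ δ, HasDerivAt (fun x => η x * P x) (A' x) x := fun x hx =>
    (hη.differentiable (by simp) x).hasDerivAt.mul (hP x hx)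
  have hA'c : ContinuousOn A' (uIcc κ δ) :=
    (hη'.continuousOn.mul hPc).add (hηc.continuousOn.mul hP'c)
  set E : ℝ → ℂ := fun t => Complex.exp (Complex.I * k * f t)
  have hE : ∀ t, HasDerivAt E (E t * (Complex.I * k * ((deriv f t : ℝ) : ℂ))) t := fun t => by
    have h1 : HasDerivAt (fun t => (f t : ℂ)) ((deriv f t : ℝ) : ℂ) t :=
      (hf.differentiable (by simp) t).hasDerivAt.ofReal_comp
    exact (h1.const_mul (Complex.I * k)).cexp
  have key := integral_mul_deriv_eq_deriv_mul (u := fun x => ((η x * P x : ℝ) : ℂ)) (v := E)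
    (a := κ) (b := δ) (u' := fun x => ((A' x : ℝ) : ℂ))
    (v' := fun t => E t * (Complex.I * k * ((deriv f t : ℝ) : ℂ)))
    (fun x hx => (hA x hx).ofReal_comp) (fun x _ => hE x)
    (ContinuousOn.intervalIntegrable (by fun_prop))
    (Continuous.intervalIntegrable (by fun_prop) _ _)
  have e1 : ∫ s in κ..δ, ((s * η s * p s : ℝ) : ℂ) * Complex.exp (Complex.I * k * f s) =
      (Complex.I * k)⁻¹ * ∫ x in κ..δ, ((η x * P x : ℝ) : ℂ) *
        (E x * (Complex.I * k * ((deriv f x : ℝ) : ℂ))) := by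
    rw [← intervalIntegral.integral_const_mul]
    refine integral_congr fun x hx => ?_
    have : (x : ℂ) ≠ 0 := by exact_mod_cast (hpos x hx).ne'
    simp only [P, E, hfp]
    push_cast
    field_simp
    ring
  have hPmono : ∀ x ∈ uIcc κ δ, P x ≤ P κ := fun x hx => by
    have hx' := hx
    rw [uIcc_of_le hκδ] at hx'
    simp only [P]
    gcongr
    exact hx'.1
  have hPnn : ∀ x ∈ uIcc κ δ, 0 ≤ P x := fun x hx => by
    have := hpos x hx
    simp only [P]
    positivity
  have hbA : ∫ x in κ..δ, (N' * P κ - N * P' x) = N' * P κ * (δ - κ) + N * (P κ - P δ) := by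
    rw [intervalIntegral.integral_sub intervalIntegrable_const
      (hP'c.intervalIntegrable.const_mul N), intervalIntegral.integral_const_mul N P',
      integral_eq_sub_of_hasDerivAt hP hP'c.intervalIntegrable, intervalIntegral.integral_const]
    simp only [smul_eq_mul]
    ring
  have hb : ‖∫ x in κ..δ, ((A' x : ℝ) : ℂ) * E x‖ ≤ N' * P κ * (δ - κ) + N * (P κ - P δ) := by
    rw [← hbA]
    refine norm_integral_le_of_norm_le hκδ (ae_of_all _ fun x hx => ?_)
      (intervalIntegrable_const.sub (hP'c.intervalIntegrable.const_mul N))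
    have hx' : x ∈ uIcc κ δ := by rw [uIcc_of_le hκδ]; exact ⟨hx.1.le, hx.2⟩
    have hxp := hpos x hx'
    have hP'neg : P' x ≤ 0 := by
      simp only [P']
      rw [neg_div]
      have : 0 ≤ j * x ^ (j - 1) / (x ^ j) ^ 2 := by positivity
      linarith
    rw [norm_ofReal_mul_cexp_I_mul]
    refine (abs_add_le _ _).trans ?_
    rw [abs_mul, abs_mul, abs_of_nonneg (hPnn x hx'), abs_of_nonpos hP'neg]
    have h1 : |deriv η x| * P x ≤ N' * P κ :=
      mul_le_mul (hN' x (hmem x hx')) (hPmono x hx') (hPnn x hx') hN0'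
    have h2 : |η x| * -P' x ≤ N * -P' x :=
      mul_le_mul_of_nonneg_right (hN x (hmem x hx')) (by linarith)
    linarith
  have hbdry : ∀ x ∈ uIcc κ δ, ‖((η x * P x : ℝ) : ℂ) * E x‖ ≤ N * P κ := fun x hx => by
    rw [norm_ofReal_mul_cexp_I_mul, abs_mul, abs_of_nonneg (hPnn x hx)]
    exact mul_le_mul (hN x (hmem x hx)) (hPmono x hx) (hPnn x hx) hN0
  have hPδ := hPnn δ right_mem_uIcc
  have hPκ := hPnn κ left_mem_uIcc
  rw [e1, key, norm_mul]
  have hn : ‖(Complex.I * (k : ℂ))⁻¹‖ = k⁻¹ := by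
    simp [abs_of_pos hk]
  rw [hn]
  refine mul_le_mul_of_nonneg_left ?_ (inv_nonneg.mpr hk.le)
  calc _ ≤ N * P κ + N * P κ + (N' * P κ * (δ - κ) + N * (P κ - P δ)) :=
        (norm_sub_le _ _).trans (add_le_add ((norm_sub_le _ _).trans
          (add_le_add (hbdry δ right_mem_uIcc) (hbdry κ left_mem_uIcc))) hb)
    _ ≤ P κ * (3 * N + N' * δ) := by
        nlinarith [mul_nonneg hN0 hPδ, mul_nonneg (mul_nonneg hN0' hPκ) hκ.le]

/-- Van der Corput type estimate: an amplitude vanishing at a degenerate stationary point of order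
`m` contributes `O(k ^ (-2 / m))`. -/
theorem isBigO_integral_id_mul {m : ℕ} (hm : 2 ≤ m) {δ : ℝ} (hδ : 0 < δ) {f p η : ℝ → ℝ}
    (hf : ContDiff ℝ ∞ f) (hp : Continuous p) (hfp : ∀ s, deriv f s = s ^ (m - 1) * p s)
    (hη : ContDiff ℝ ∞ η) :
    (fun k : ℝ => ∫ s in (0 : ℝ)..δ,
      ((s * η s * p s : ℝ) : ℂ) * Complex.exp (Complex.I * k * f s)) =O[atTop]
      fun k : ℝ => 1 / k ^ (2 / (m : ℝ)) := by
  obtain ⟨j, rfl⟩ : ∃ j, m = j + 2 := ⟨m - 2, by omega⟩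
  have hηc := hη.continuous
  have hfc := hf.continuous
  have hη' : Continuous (deriv η) := hη.continuous_deriv (by simp)
  obtain ⟨M, hM⟩ := (isCompact_Icc (a := 0) (b := δ)).exists_bound_of_continuousOn
    (hηc.mul hp).continuousOn
  obtain ⟨N, hN⟩ := (isCompact_Icc (a := 0) (b := δ)).exists_bound_of_continuousOn
    hηc.continuousOn
  obtain ⟨N', hN'⟩ := (isCompact_Icc (a := 0) (b := δ)).exists_bound_of_continuousOn
    hη'.continuousOn
  have hM0 : 0 ≤ M := (norm_nonneg _).trans (hM 0 ⟨le_rfl, hδ.le⟩)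
  refine IsBigO.of_bound (M + (3 * N + N' * δ)) ?_
  filter_upwards [eventually_gt_atTop 0, eventually_ge_atTop ((δ ^ (j + 2))⁻¹)] with k hk hkδ
  -- The cut `κ = k ^ (-1/m)` balances the trivial bound `M κ ^ 2` on `[0, κ]` against `k⁻¹ κ ^ (-j)
  -- = κ ^ 2` on `[κ, δ]`; the lower bound on `k` ensures `κ ≤ δ`.
  set κ : ℝ := k⁻¹ ^ (1 / ((j + 2 : ℕ) : ℝ))
  have hκ : 0 < κ := by positivity
  have hκm : κ ^ (j + 2) = k⁻¹ := by
    simp only [κ]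
    rw [one_div, Real.rpow_inv_natCast_pow (by positivity) (by omega)]
  have hκδ : κ ≤ δ := by
    refine (pow_le_pow_iff_left₀ hκ.le hδ.le (n := j + 2) (by omega)).mp ?_
    rw [hκm]
    exact inv_le_of_inv_le₀ (by positivity) hkδ
  have hκ2 : 1 / k ^ (2 / ((j + 2 : ℕ) : ℝ)) = κ ^ 2 := by
    simp only [κ]
    rw [← Real.rpow_natCast, ← Real.rpow_mul (by positivity), Real.inv_rpow hk.le, one_div]
    congr 2
    push_cast
    ring
  rw [hκ2, Real.norm_of_nonneg (by positivity : 0 ≤ κ ^ 2)]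
  have hii : ∀ x y : ℝ, IntervalIntegrable (fun s =>
      ((s * η s * p s : ℝ) : ℂ) * Complex.exp (Complex.I * k * f s)) volume x y := fun x y =>
    Continuous.intervalIntegrable (by fun_prop) _ _
  rw [← integral_add_adjacent_intervals (hii 0 κ) (hii κ δ)]
  have h1 : ‖∫ s in (0 : ℝ)..κ,
      ((s * η s * p s : ℝ) : ℂ) * Complex.exp (Complex.I * k * f s)‖ ≤ κ * M * |κ - 0| := by
    refine norm_integral_le_of_norm_le_const fun s hs => ?_
    rw [uIoc_of_le hκ.le] at hs
    rw [norm_ofReal_mul_cexp_I_mul, mul_assoc, abs_mul, abs_of_pos hs.1]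
    exact mul_le_mul hs.2 (hM s ⟨hs.1.le, hs.2.trans hκδ⟩) (abs_nonneg _) hκ.le
  have h2 := norm_integral_id_mul_le hf hfp hη hκ hκδ hk (fun s hs => hN s hs)
    (fun s hs => hN' s hs)
  rw [← hκm] at h2
  have h3 : κ ^ (j + 2) * ((κ ^ j)⁻¹ * (3 * N + N' * δ)) = (3 * N + N' * δ) * κ ^ 2 := by
    field_simp
    ring
  rw [h3] at h2
  rw [sub_zero, abs_of_pos hκ] at h1
  calc _ ≤ κ * M * κ + (3 * N + N' * δ) * κ ^ 2 := (norm_add_le _ _).trans (add_le_add h1 h2)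
    _ = _ := by ring

/-! ### One-sided expansion at a stationary point -/

theorem isBigO_one_div_rpow {m : ℕ} (hm : 2 ≤ m) :
    (fun k : ℝ => 1 / k) =O[atTop] fun k : ℝ => 1 / k ^ (2 / (m : ℝ)) := by
  refine IsBigO.of_bound 1 ?_
  filter_upwards [eventually_ge_atTop 1] with k hk
  have hk0 : 0 < k := by linarith
  have hm' : (2 : ℝ) ≤ m := by exact_mod_cast hm
  rw [one_mul, Real.norm_of_nonneg (by positivity), Real.norm_of_nonneg (by positivity)]
  refine one_div_le_one_div_of_le (by positivity) ?_
  calc k ^ (2 / (m : ℝ)) ≤ k ^ (1 : ℝ) :=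
        Real.rpow_le_rpow_of_exponent_le hk (by rw [div_le_one (by linarith)]; exact hm')
    _ = k := Real.rpow_one k

/-- The principal argument of `-ikσ` is `-σπ/2`; the exponent `-1/m` turns it into the phase
`σπ/(2m)`. -/
theorem neg_I_mul_cpow {k σ : ℝ} (hk : 0 < k) (hσ : σ = 1 ∨ σ = -1) (m : ℕ) :
    (-(Complex.I * ((k * σ : ℝ) : ℂ))) ^ (-(1 / (m : ℂ))) =
      ((k⁻¹ ^ (1 / (m : ℝ)) : ℝ) : ℂ) *
        Complex.exp ((σ : ℂ) * Complex.I * (Real.pi / (2 * m))) := by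
  have hlog : Complex.log (-(Complex.I * ((k * σ : ℝ) : ℂ))) =
      (Real.log k : ℂ) - σ * Complex.I * (Real.pi / 2) := by
    rcases hσ with rfl | rfl
    · rw [show -(Complex.I * ((k * 1 : ℝ) : ℂ)) = (k : ℂ) * (-Complex.I) by push_cast; ring,
        Complex.log_ofReal_mul hk (by simp), Complex.log_neg_I]
      push_cast
      ring
    · rw [show -(Complex.I * ((k * -1 : ℝ) : ℂ)) = (k : ℂ) * Complex.I by push_cast; ring,
        Complex.log_ofReal_mul hk (by simp), Complex.log_I]
      push_cast
      ring
  have hne : -(Complex.I * ((k * σ : ℝ) : ℂ)) ≠ 0 := by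
    have : k * σ ≠ 0 := by rcases hσ with rfl | rfl <;> simp [hk.ne']
    simpa using this
  rw [Complex.cpow_def_of_ne_zero hne, hlog, Real.rpow_def_of_pos (inv_pos.mpr hk), Real.log_inv,
    Complex.ofReal_exp, ← Complex.exp_add]
  congr 1
  push_cast
  ring

theorem isBigO_fresnel_sub {m : ℕ} (hm : 2 ≤ m) {U : ℝ} (hU : 0 < U) {σ : ℝ}
    (hσ : σ = 1 ∨ σ = -1) :
    (fun k : ℝ => (∫ x in (0 : ℝ)..U, Complex.exp (Complex.I * ((k * σ : ℝ) : ℂ) * (x : ℂ) ^ m)) -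
      Real.Gamma (1 / m + 1) * (((k⁻¹ ^ (1 / (m : ℝ)) : ℝ) : ℂ) *
        Complex.exp ((σ : ℂ) * Complex.I * (Real.pi / (2 * m))))) =O[atTop]
      fun k : ℝ => 1 / k := by
  refine IsBigO.of_bound (3 / U ^ (m - 1)) ?_
  filter_upwards [eventually_gt_atTop 0] with k hk
  have hσ1 : |σ| = 1 := by rcases hσ with rfl | rfl <;> simp
  have hne : k * σ ≠ 0 := by rcases hσ with rfl | rfl <;> simp [hk.ne']
  have h := norm_fresnel_sub_le hm hU hne
  rw [neg_I_mul_cpow hk hσ] at h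
  refine h.trans (le_of_eq ?_)
  rw [abs_mul, hσ1, abs_of_pos hk, Real.norm_of_nonneg (by positivity)]
  field_simp

/-- One-sided stationary phase expansion at the origin. -/
theorem exists_isBigO_integral_sub {f : ℝ → ℝ} (hf : ContDiff ℝ ∞ f) {m : ℕ} (hm : 2 ≤ m)
    (hlow : ∀ j, 1 ≤ j → j < m → iteratedDeriv j f 0 = 0) (hne : iteratedDeriv m f 0 ≠ 0) :
    ∃ δ₀ > 0, ∀ δ, 0 < δ → δ ≤ δ₀ → ∀ g : ℝ → ℝ, ContDiff ℝ ∞ g →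
      (fun k : ℝ => (∫ s in (0 : ℝ)..δ, (g s : ℂ) * Complex.exp (Complex.I * k * f s)) -
        (g 0 : ℂ) * Real.Gamma (1 / m + 1) *
          (((m.factorial / (k * |iteratedDeriv m f 0|)) ^ (1 / (m : ℝ)) : ℝ) : ℂ) *
          Complex.exp ((Real.sign (iteratedDeriv m f 0) : ℂ) * Complex.I * (Real.pi / (2 * m))) *
          Complex.exp (Complex.I * k * f 0)) =O[atTop]
      fun k : ℝ => 1 / k ^ (2 / (m : ℝ)) := by
  have hm0 : (0 : ℝ) < m := by exact_mod_cast (by omega : 0 < m)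
  have hfact : (0 : ℝ) < m.factorial := by exact_mod_cast m.factorial_pos
  obtain ⟨H, hH, hfH, hD⟩ := exists_contDiff_eq_pow_mul m (F := fun s => f s - f 0)
    (hf.sub contDiff_const) (fun j hj => by
      rcases Nat.eq_zero_or_pos j with rfl | h
      · simp
      · rw [show (fun s => f s - f 0) = fun s => -f 0 + f s by funext s; ring,
          iteratedDeriv_const_add h]
        exact hlow j h hj)
  have hD : iteratedDeriv m f 0 = m.factorial * H 0 := by
    rw [← hD, show (fun s => f s - f 0) = fun s => -f 0 + f s by funext s; ring,
      iteratedDeriv_const_add (by omega)]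
  have hH0 : H 0 ≠ 0 := fun h => hne (by rw [hD, h, mul_zero])
  rw [hD]
  set σ : ℝ := Real.sign (m.factorial * H 0) with hσdef
  have hσH : Real.sign (H 0) = σ := by
    rcases hH0.lt_or_gt with h | h
    · rw [hσdef, Real.sign_of_neg h, Real.sign_of_neg (mul_neg_of_pos_of_neg hfact h)]
    · rw [hσdef, Real.sign_of_pos h, Real.sign_of_pos (mul_pos hfact h)]
  have hσ : σ = 1 ∨ σ = -1 := by
    rw [← hσH]
    rcases hH0.lt_or_gt with h | h
    · exact Or.inr (Real.sign_of_neg h)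
    · exact Or.inl (Real.sign_of_pos h)
  have hσσ : σ * σ = 1 := by rcases hσ with h | h <;> rw [h] <;> norm_num
  have hσabs : σ * H 0 = |H 0| := by
    rw [← hσH]
    rcases hH0.lt_or_gt with h | h
    · rw [Real.sign_of_neg h, abs_of_neg h]; ring
    · rw [Real.sign_of_pos h, abs_of_pos h]; ring
  have hHc := hH.continuous
  have hfc := hf.continuous
  have hH' : ContDiff ℝ ∞ (deriv H) := (contDiff_infty_iff_deriv.mp hH).2
  have hH'c := hH'.continuous
  set p : ℝ → ℝ := fun s => m * H s + s * deriv H s with hp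
  have hpd : ContDiff ℝ ∞ p := (contDiff_const.mul hH).add (contDiff_id.mul hH')
  have hpc : Continuous p := hpd.continuous
  have hfp : ∀ s, deriv f s = s ^ (m - 1) * p s := by
    intro s
    have h1 : f = fun s => f 0 + s ^ m * H s := by
      funext s
      rw [← hfH]
      ring
    have h2 : HasDerivAt (fun s => f 0 + s ^ m * H s)
        (m * s ^ (m - 1) * H s + s ^ m * deriv H s) s :=
      ((hasDerivAt_pow m s).mul (hH.differentiable (by simp) s).hasDerivAt).const_add _
    rw [h1, h2.deriv]
    obtain ⟨n, rfl⟩ : ∃ n, m = n + 1 := ⟨m - 1, by omega⟩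
    simp only [hp, Nat.add_sub_cancel]
    ring
  -- On `N` the `m`-th root of `σ H` is smooth and division by `p` is allowed; `0` lies in it
  -- because `p 0 = m * H 0`.
  set N : Set ℝ := {s | 0 < σ * H s} ∩ {s | p s ≠ 0}
  have hNo : IsOpen N :=
    (isOpen_lt continuous_const (by fun_prop)).inter (isOpen_ne_fun hpc continuous_const)
  have h0N : (0 : ℝ) ∈ N := by
    refine ⟨?_, ?_⟩
    · show 0 < σ * H 0
      rw [hσabs]; exact abs_pos.mpr hH0
    · show p 0 ≠ 0
      simp [hp, hH0, hm0.ne']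
  set q : ℝ → ℝ := fun s => (σ * H s) ^ (1 / (m : ℝ)) with hq
  have hqN : ContDiffOn ℝ ∞ q N := fun s hs =>
    ((contDiff_const.mul hH).contDiffAt.rpow_const_of_ne hs.1.ne').contDiffWithinAt
  have hq'N : ContDiffOn ℝ ∞ (deriv q) N := hqN.deriv_of_isOpen hNo (by simp)
  have hqpos : ∀ s ∈ N, 0 < q s := fun s hs => Real.rpow_pos_of_pos hs.1 _
  have hqm : ∀ s ∈ N, q s ^ m = σ * H s := fun s hs => by
    simp only [hq, one_div]
    exact Real.rpow_inv_natCast_pow (le_of_lt hs.1) (by omega)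
  have hqd : ∀ s ∈ N, HasDerivAt q (deriv q s) s := fun s hs =>
    (((hqN s hs).contDiffAt (hNo.mem_nhds hs)).differentiableAt (by simp)).hasDerivAt
  obtain ⟨r, hr, hrN⟩ := Metric.isOpen_iff.mp hNo 0 h0N
  -- The cutoff makes `G` below smooth on the whole line, as Hadamard's lemma requires, without
  -- changing it on `[0, δ]`.
  let χ : ContDiffBump (0 : ℝ) := ⟨r / 4, r / 2, by linarith, by linarith⟩
  have hχN : tsupport χ ⊆ N := by
    rw [χ.tsupport_eq]
    exact (Metric.closedBall_subset_ball (by show r / 2 < r; linarith)).trans hrN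
  refine ⟨r / 4, by positivity, fun δ hδ hδr g hg => ?_⟩
  have hIcc : ∀ s ∈ Icc 0 δ, s ∈ N ∧ χ s = 1 := by
    intro s hs
    have h1 : dist s 0 ≤ r / 4 := by
      rw [Real.dist_eq, sub_zero, abs_of_nonneg hs.1]; exact hs.2.trans hδr
    exact ⟨hrN (lt_of_le_of_lt h1 (by linarith)), χ.one_of_mem_closedBall h1⟩
  set u : ℝ → ℝ := fun s => s * q s with hu
  set u' : ℝ → ℝ := fun s => q s + s * deriv q s with hu'
  have hud : ∀ s ∈ N, HasDerivAt u (u' s) s := fun s hs => by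
    have := (hasDerivAt_id' s).fun_mul (hqd s hs)
    simpa [hu, hu'] using this
  have hu'N : ContDiffOn ℝ ∞ u' N := hqN.add (contDiff_id.contDiffOn.mul hq'N)
  -- As `u' 0 = q 0`, this choice makes `g - c u'` vanish at `0`.
  set c : ℝ := g 0 / q 0 with hc
  have hq0 := hqpos 0 h0N
  set G : ℝ → ℝ := fun s => χ s * ((g s - c * u' s) / p s) with hG
  have hGd : ContDiff ℝ ∞ G := by
    refine contDiff_of_contDiffAt_tsupport fun t ht => ?_
    have htN : t ∈ N := hχN (tsupport_mul_subset_left ht)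
    refine χ.contDiffAt.mul (ContDiffAt.div (hg.contDiffAt.sub (contDiffAt_const.mul
      ((hu'N t htN).contDiffAt (hNo.mem_nhds htN)))) hpd.contDiffAt htN.2)
  have hG0 : G 0 = 0 := by
    simp only [hG, hu', hc, zero_mul, add_zero]
    rw [div_mul_cancel₀ _ hq0.ne', sub_self, zero_div, mul_zero]
  obtain ⟨η, hη, hGη⟩ := exists_contDiff_eq_id_mul hGd hG0
  have hw : ∀ s ∈ Icc 0 δ, g s = c * u' s + s * η s * p s := by
    intro s hs
    obtain ⟨hsN, hs1⟩ := hIcc s hs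
    have hps : p s ≠ 0 := hsN.2
    rw [← hGη, hG]
    simp only [hs1, one_mul]
    rw [div_mul_cancel₀ _ hps]
    ring
  have hphase : ∀ s ∈ Icc 0 δ, f s = f 0 + σ * u s ^ m := by
    intro s hs
    have h1 := hfH s
    simp only [hu]
    rw [mul_pow, hqm s (hIcc s hs).1, mul_left_comm, ← mul_assoc σ σ, hσσ, one_mul]
    linarith
  have huIcc : uIcc 0 δ = Icc 0 δ := uIcc_of_le hδ.le
  have hu'c : ContinuousOn u' (Icc 0 δ) := hu'N.continuousOn.mono fun s hs => (hIcc s hs).1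
  have hU : 0 < u δ := mul_pos hδ (hqpos δ (hIcc δ (right_mem_Icc.mpr hδ.le)).1)
  have hsplit : ∀ k : ℝ, ∫ s in (0 : ℝ)..δ, (g s : ℂ) * Complex.exp (Complex.I * k * f s) =
      (c : ℂ) * Complex.exp (Complex.I * k * f 0) *
        (∫ x in (0 : ℝ)..u δ, Complex.exp (Complex.I * ((k * σ : ℝ) : ℂ) * (x : ℂ) ^ m)) +
      ∫ s in (0 : ℝ)..δ, ((s * η s * p s : ℝ) : ℂ) * Complex.exp (Complex.I * k * f s) := by
    intro k
    have hsub := integral_deriv_smul_comp' (a := 0) (b := δ) (f := u) (f' := u')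
      (g := fun x : ℝ => Complex.exp (Complex.I * ((k * σ : ℝ) : ℂ) * (x : ℂ) ^ m))
      (fun x hx => hud x (hIcc x (huIcc ▸ hx)).1) (by rwa [huIcc]) (by fun_prop)
    have hu0 : u 0 = 0 := by simp [hu]
    rw [hu0] at hsub
    have hηc := hη.continuous
    have huc : ContinuousOn u (Icc 0 δ) := fun x hx =>
      (hud x (hIcc x hx).1).continuousAt.continuousWithinAt
    rw [← hsub, ← intervalIntegral.integral_const_mul, ← intervalIntegral.integral_add]
    · refine integral_congr fun s hs => ?_
      rw [huIcc] at hs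
      simp only [Function.comp_apply]
      rw [hw s hs, hphase s hs, Complex.real_smul]
      push_cast
      rw [mul_add (Complex.I * (k : ℂ)), Complex.exp_add]
      ring_nf
    · refine ContinuousOn.intervalIntegrable ?_
      rw [huIcc]
      simp only [Function.comp_def]
      fun_prop
    · exact Continuous.intervalIntegrable (by fun_prop) _ _
  have hmain := ((isBigO_fresnel_sub hm hU hσ).trans (isBigO_one_div_rpow hm))
  have hexp : (fun k : ℝ => (c : ℂ) * Complex.exp (Complex.I * k * f 0)) =O[atTop]
      fun _ : ℝ => (1 : ℝ) := by
    refine IsBigO.of_bound |c| (Eventually.of_forall fun k => ?_)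
    rw [norm_ofReal_mul_cexp_I_mul]
    simp
  have h1 := hexp.mul hmain
  simp only [one_mul] at h1
  refine (h1.add (isBigO_integral_id_mul hm hδ hf hpc hfp hη)).congr' ?_ EventuallyEq.rfl
  filter_upwards [eventually_gt_atTop 0] with k hk
  rw [hsplit k]
  have hscale : (c : ℂ) * ((k⁻¹ ^ (1 / (m : ℝ)) : ℝ) : ℂ) =
      (g 0 : ℂ) * (((m.factorial / (k * |m.factorial * H 0|)) ^ (1 / (m : ℝ)) : ℝ) : ℂ) := by
    rw [← Complex.ofReal_mul, ← Complex.ofReal_mul]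
    congr 1
    have hHp : 0 < |H 0| := abs_pos.mpr hH0
    rw [abs_mul, abs_of_pos hfact, show (m.factorial : ℝ) / (k * (m.factorial * |H 0|)) =
      k⁻¹ / |H 0| by field_simp, Real.div_rpow (by positivity) hHp.le, hc, hq]
    simp only [hσabs]
    ring
  linear_combination (-(Real.Gamma (1 / m + 1) : ℂ) * Complex.exp (Complex.I * k * f 0) *
    Complex.exp ((σ : ℂ) * Complex.I * (Real.pi / (2 * m)))) * hscale

/-! ### Two-sided expansion and summation over stationary points -/

/-- Leading contribution of a stationary point `t` of order `m` with amplitude `a`, written as the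
sum of the contributions of the two sides of `t`. -/
noncomputable def stationaryTerm (f : ℝ → ℝ) (m : ℕ) (a t k : ℝ) : ℂ :=
  (a : ℂ) * Real.Gamma (1 / m + 1) *
    (((m.factorial / (k * |iteratedDeriv m f t|)) ^ (1 / (m : ℝ)) : ℝ) : ℂ) *
    (Complex.exp ((Real.sign (iteratedDeriv m f t) : ℂ) * Complex.I * (Real.pi / (2 * m))) +
      Complex.exp ((Real.sign ((-1) ^ m * iteratedDeriv m f t) : ℂ) * Complex.I *
        (Real.pi / (2 * m)))) *
    Complex.exp (Complex.I * k * f t)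

/-- Two-sided stationary phase expansion for amplitudes supported near a stationary point. -/
theorem exists_isBigO_integral_sub_stationaryTerm {f : ℝ → ℝ} (hf : ContDiff ℝ ∞ f) {m : ℕ}
    (hm : 2 ≤ m) {t₀ : ℝ} (hlow : ∀ j, 1 ≤ j → j < m → iteratedDeriv j f t₀ = 0)
    (hne : iteratedDeriv m f t₀ ≠ 0) :
    ∃ δ > 0, ∀ g : ℝ → ℝ, ContDiff ℝ ∞ g → tsupport g ⊆ Metric.ball t₀ δ →
      (fun k : ℝ => (∫ t, (g t : ℂ) * Complex.exp (Complex.I * k * f t)) -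
        stationaryTerm f m (g t₀) t₀ k) =O[atTop] fun k : ℝ => 1 / k ^ (2 / (m : ℝ)) := by
  have hR : ∀ j, iteratedDeriv j (fun s => f (t₀ + s)) 0 = iteratedDeriv j f t₀ := fun j => by
    simp [iteratedDeriv_comp_const_add]
  -- Reflection produces the factor `(-1) ^ m` in the second sign of `stationaryTerm`.
  have hL : ∀ j, iteratedDeriv j (fun s => f (t₀ - s)) 0 = (-1) ^ j * iteratedDeriv j f t₀ :=
    fun j => by
      have := iteratedDeriv_comp_neg j (fun s => f (t₀ + s)) 0
      rw [neg_zero, hR, smul_eq_mul] at this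
      simpa [sub_eq_add_neg] using this
  obtain ⟨δ₁, hδ₁, h₁⟩ := exists_isBigO_integral_sub (f := fun s => f (t₀ + s)) (by fun_prop) hm
    (fun j hj hjm => by rw [hR, hlow j hj hjm]) (by rwa [hR])
  obtain ⟨δ₂, hδ₂, h₂⟩ := exists_isBigO_integral_sub (f := fun s => f (t₀ - s)) (by fun_prop) hm
    (fun j hj hjm => by rw [hL, hlow j hj hjm, mul_zero])
    (by rw [hL]; exact mul_ne_zero (pow_ne_zero _ (by norm_num)) hne)
  have hδ : 0 < min δ₁ δ₂ := lt_min hδ₁ hδ₂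
  refine ⟨min δ₁ δ₂, hδ, fun g hg hgs => ?_⟩
  have hgc := hg.continuous
  have hfc := hf.continuous
  set δ := min δ₁ δ₂
  have h₁ := h₁ δ hδ (min_le_left _ _) (fun s => g (t₀ + s)) (by fun_prop)
  have h₂ := h₂ δ hδ (min_le_right _ _) (fun s => g (t₀ - s)) (by fun_prop)
  refine (h₁.add h₂).congr_left fun k => ?_
  set h : ℝ → ℂ := fun t => (g t : ℂ) * Complex.exp (Complex.I * k * f t) with hh
  have hc : Continuous h := by fun_prop
  have hsupp : Function.support h ⊆ Ioc (t₀ - δ) (t₀ + δ) := by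
    intro t ht
    have : t ∈ Metric.ball t₀ δ := hgs (subset_closure fun h0 => ht (by simp [hh, h0]))
    rw [Real.ball_eq_Ioo] at this
    exact Ioo_subset_Ioc_self this
  have hI : ∫ t, h t = (∫ s in (0 : ℝ)..δ, h (t₀ + s)) + ∫ s in (0 : ℝ)..δ, h (t₀ - s) := by
    rw [← integral_eq_integral_of_support_subset hsupp,
      ← integral_add_adjacent_intervals (hc.intervalIntegrable _ t₀) (hc.intervalIntegrable _ _),
      integral_comp_sub_left, integral_comp_add_left, sub_zero, add_zero, add_comm]
  rw [hI, hR, hL]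
  simp only [hh, stationaryTerm, add_zero, sub_zero]
  rw [abs_mul, abs_pow, abs_neg, abs_one, one_pow, one_mul]
  ring

/-- Stationary phase expansion for a finite set of stationary points of finite order. -/
theorem exists_integral_eq_sum_stationaryTerm {f : ℝ → ℝ} (hf : ContDiff ℝ ∞ f) (m : ℝ → ℕ)
    (T : Finset ℝ) (hm : ∀ t ∈ T, 2 ≤ m t)
    (hlow : ∀ t ∈ T, ∀ j, 1 ≤ j → j < m t → iteratedDeriv j f t = 0)
    (hne : ∀ t ∈ T, iteratedDeriv (m t) f t ≠ 0) {g : ℝ → ℝ} (hg : ContDiff ℝ ∞ g)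
    (hgc : HasCompactSupport g) (hT : ∀ t ∈ tsupport g, deriv f t = 0 → t ∈ T) :
    ∃ (r : ℝ → ℝ → ℂ) (R : ℝ → ℂ),
      (∀ t ∈ T, r t =O[atTop] fun k : ℝ => 1 / k ^ (2 / (m t : ℝ))) ∧
      (R =O[atTop] fun k : ℝ => 1 / k) ∧
      ∀ k : ℝ, ∫ t, (g t : ℂ) * Complex.exp (Complex.I * k * f t) =
        ∑ t ∈ T, (stationaryTerm f (m t) (g t) t k + r t k) + R k := by
  have hfc := hf.continuous
  induction T using Finset.induction_on generalizing g with
  | empty =>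
    refine ⟨0, fun k => ∫ t, (g t : ℂ) * Complex.exp (Complex.I * k * f t), by simp, ?_, by simp⟩
    have := isBigO_integral_mul_cexp_of_deriv_ne_zero hf 1 hg hgc
      fun t ht h0 => by simpa using hT t ht h0
    simpa using this
  | insert t₀ T ht₀ ih =>
    have hmem := Finset.mem_insert_self t₀ T
    obtain ⟨δ, hδ, hloc⟩ := exists_isBigO_integral_sub_stationaryTerm hf (hm t₀ hmem)
      (hlow t₀ hmem) (hne t₀ hmem)
    obtain ⟨ε, hε, hεT⟩ := Metric.isOpen_iff.mp T.finite_toSet.isClosed.isOpen_compl t₀ ht₀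
    -- Radius `δ` validates the local expansion; `ε` keeps the cutoff away from the other points, so
    -- amplitudes there are unchanged.
    set ρ := min δ ε
    have hρ : 0 < ρ := lt_min hδ hε
    let χ : ContDiffBump t₀ := ⟨ρ / 4, ρ / 2, by linarith, by linarith⟩
    have hχs : tsupport χ ⊆ Metric.ball t₀ ρ := by
      rw [χ.tsupport_eq]
      exact Metric.closedBall_subset_ball (by show ρ / 2 < ρ; linarith)
    have hχT : ∀ t ∈ T, χ t = 0 := by
      intro t ht
      by_contra h0
      have h1 : t ∈ Metric.ball t₀ ε :=
        Metric.ball_subset_ball (min_le_right _ _) (hχs (subset_closure h0))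
      exact hεT h1 ht
    have hχ₀ : χ t₀ = 1 := χ.eventuallyEq_one.self_of_nhds
    have hχd : ContDiff ℝ ∞ χ := χ.contDiff
    have hg₁ : ContDiff ℝ ∞ fun t => χ t * g t := hχd.mul hg
    have hg₂ : ContDiff ℝ ∞ fun t => (1 - χ t) * g t := (contDiff_const.sub hχd).mul hg
    have hts : tsupport (fun t => (1 - χ t) * g t) ⊆ tsupport g := tsupport_mul_subset_right
    have hg₂c : HasCompactSupport fun t => (1 - χ t) * g t := hgc.mul_left
    have hg₁c : HasCompactSupport fun t => χ t * g t := hgc.mul_left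
    -- The cutoff is `1` on a whole neighbourhood of `t₀`, so the remaining amplitude no longer sees
    -- this point and the induction hypothesis applies.
    have ht₀ts : t₀ ∉ tsupport fun t => (1 - χ t) * g t := by
      rw [notMem_tsupport_iff_eventuallyEq]
      filter_upwards [χ.eventuallyEq_one] with t ht
      simp [ht]
    obtain ⟨r, R, hr, hR, hI⟩ := ih (fun t ht => hm t (Finset.mem_insert_of_mem ht))
      (fun t ht => hlow t (Finset.mem_insert_of_mem ht))
      (fun t ht => hne t (Finset.mem_insert_of_mem ht)) hg₂ hg₂c fun t ht h0 =>
        (Finset.mem_insert.mp (hT t (hts ht) h0)).resolve_left fun h => ht₀ts (h ▸ ht)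
    have hloc' := hloc _ hg₁ (tsupport_mul_subset_left.trans
      (hχs.trans (Metric.ball_subset_ball (min_le_left _ _))))
    simp only [hχ₀, one_mul] at hloc'
    refine ⟨Function.update r t₀ fun k =>
      (∫ t, ((χ t * g t : ℝ) : ℂ) * Complex.exp (Complex.I * k * f t)) -
        stationaryTerm f (m t₀) (g t₀) t₀ k, R, fun t ht => ?_, hR, fun k => ?_⟩
    · rcases Finset.mem_insert.mp ht with rfl | ht'
      · rw [Function.update_self]
        exact hloc'
      · rw [Function.update_of_ne (ne_of_mem_of_not_mem ht' ht₀)]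
        exact hr t ht'
    · have hint : ∀ {q : ℝ → ℝ}, Continuous q → HasCompactSupport q →
          Integrable fun t => (q t : ℂ) * Complex.exp (Complex.I * k * f t) := by
        intro q hq hqc
        have h1 : HasCompactSupport (fun t => (q t : ℂ)) :=
          HasCompactSupport.comp_left (g := Complex.ofReal) hqc Complex.ofReal_zero
        exact Continuous.integrable_of_hasCompactSupport (by fun_prop) h1.mul_right
      have hsplit : ∫ t, (g t : ℂ) * Complex.exp (Complex.I * k * f t) =
          (∫ t, ((χ t * g t : ℝ) : ℂ) * Complex.exp (Complex.I * k * f t)) +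
            ∫ t, (((1 - χ t) * g t : ℝ) : ℂ) * Complex.exp (Complex.I * k * f t) := by
        rw [← MeasureTheory.integral_add (hint hg₁.continuous hg₁c) (hint hg₂.continuous hg₂c)]
        congr 1
        funext t
        push_cast
        ring
      rw [hsplit, hI, Finset.sum_insert ht₀, Function.update_self]
      have hsum : ∑ t ∈ T, (stationaryTerm f (m t) ((1 - χ t) * g t) t k + r t k) =
          ∑ t ∈ T, (stationaryTerm f (m t) (g t) t k + Function.update r t₀ (fun k =>
            (∫ t, ((χ t * g t : ℝ) : ℂ) * Complex.exp (Complex.I * k * f t)) -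
              stationaryTerm f (m t₀) (g t₀) t₀ k) t k) := by
        refine Finset.sum_congr rfl fun t ht => ?_
        rw [Function.update_of_ne (ne_of_mem_of_not_mem ht ht₀), hχT t ht, sub_zero, one_mul]
      rw [hsum]
      ring

end

namespace StationaryPhase

/-! ### Even and odd terms, and the theorem -/

theorem C_eq {m : ℕ} (hm : 2 ≤ m) : C m = 2 * Real.Gamma (1 / m + 1) := by
  have hm0 : (0 : ℝ) < m := by exact_mod_cast (by omega : 0 < m)
  rw [C, ← integral_exp_neg_rpow hm0]
  simp only [Real.rpow_natCast]

theorem evenTerm_eq {Ω : Type*} (φ f : ℝ → Ω → ℝ) (ω : Ω) {m : ℕ} (hm : 2 ≤ m) (he : Even m)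
    (t k : ℝ) : evenTerm φ f ω m t k = stationaryTerm (fun s => f s ω) m (φ t ω) t k := by
  simp only [evenTerm, stationaryTerm, scale, tDeriv, C_eq hm, he.neg_one_pow, one_mul]
  push_cast
  ring

/-- For odd `m` the two sides carry opposite signs, and the sum of the conjugate phases is `2 cos
(π/(2m))` whichever sign comes first. -/
theorem oddTerm_eq {Ω : Type*} (φ f : ℝ → Ω → ℝ) (ω : Ω) {m : ℕ} (hm : 2 ≤ m) (ho : Odd m)
    (t k : ℝ) (hne : tDeriv m f t ω ≠ 0) :
    oddTerm φ f ω m t k = stationaryTerm (fun s => f s ω) m (φ t ω) t k := by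
  have hcos : ((Real.cos (Real.pi / (2 * m)) : ℝ) : ℂ) * 2 =
      Complex.exp ((Real.sign (tDeriv m f t ω) : ℂ) * Complex.I * (Real.pi / (2 * m))) +
      Complex.exp ((Real.sign ((-1) ^ m * tDeriv m f t ω) : ℂ) * Complex.I *
        (Real.pi / (2 * m))) := by
    rw [ho.neg_one_pow, neg_one_mul, Real.sign_neg, Complex.ofReal_cos, Complex.cos]
    push_cast
    rcases hne.lt_or_gt with h | h
    · rw [Real.sign_of_neg h]
      push_cast
      ring_nf
    · rw [Real.sign_of_pos h]
      push_cast
      ring_nf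
  simp only [tDeriv] at hcos
  simp only [oddTerm, stationaryTerm, scale, tDeriv, C_eq hm, ← hcos]
  push_cast
  ring

end StationaryPhase

theorem theorem1 {Ω : Type*} (φ f : ℝ → Ω → ℝ) (a b : Ω → ℝ)
    (hφ : ∀ ω, ContDiff ℝ ((⊤ : ℕ∞) : WithTop ℕ∞) (fun t => φ t ω))
    (hf : ∀ ω, ContDiff ℝ ((⊤ : ℕ∞) : WithTop ℕ∞) (fun t => f t ω))
    (hsupp : ∀ ω, tsupport (fun t => φ t ω) ⊆ Icc (a ω) (b ω))
    (ω : Ω) :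
    ((∀ t ∈ Icc (a ω) (b ω), (t, ω) ∉ StationaryPhase.St f) →
      ∀ n : ℕ, (fun k : ℝ => StationaryPhase.highFreqIntegral φ f k ω)
        =O[atTop] (fun k : ℝ => 1 / k ^ n)) ∧
    (∀ (T : Finset ℝ) (m : ℝ → ℕ), T.Nonempty →
      (∀ t, t ∈ T ↔ t ∈ Icc (a ω) (b ω) ∧ (t, ω) ∈ StationaryPhase.St f) →
      (∀ t ∈ T, (t, ω) ∈ StationaryPhase.StOrder f (m t)) →
      ∃ r : ℝ → ℝ → ℂ,
        (∀ t ∈ T, (fun k : ℝ => r t k)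
          =O[atTop] (fun k : ℝ => 1 / k ^ (2 / (m t : ℝ)))) ∧
        ∀ k : ℝ, 0 < k →
          StationaryPhase.highFreqIntegral φ f k ω =
            ∑ t ∈ T with Even (m t), (StationaryPhase.evenTerm φ f ω (m t) t k + r t k) +
            ∑ t ∈ T with Odd (m t), (StationaryPhase.oddTerm φ f ω (m t) t k + r t k)) := by
  have hgc : HasCompactSupport fun t => φ t ω :=
    isCompact_Icc.of_isClosed_subset (isClosed_tsupport _) (hsupp ω)
  refine ⟨fun hns n => ?_, fun T m hTne hT hord => ?_⟩
  · exact isBigO_integral_mul_cexp_of_deriv_ne_zero (hf ω) n (hφ ω) hgc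
      fun t ht => hns t (hsupp ω ht)
  -- Order `1` would mean `f' ≠ 0`, contradicting stationarity.
  · have hm : ∀ t ∈ T, 2 ≤ m t := by
      intro t ht
      obtain ⟨hst, ⟨h1, hne⟩, -⟩ := hord t ht
      have hst : deriv (fun s => f s ω) t = 0 := hst
      by_contra hlt
      have h1' : m t = 1 := by omega
      rw [h1', StationaryPhase.tDeriv, iteratedDeriv_one] at hne
      exact hne hst
    have hlow : ∀ t ∈ T, ∀ j, 1 ≤ j → j < m t → iteratedDeriv j (fun s => f s ω) t = 0 := by
      intro t ht j hj hjm
      by_contra hne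
      exact absurd ((hord t ht).2.2 ⟨hj, hne⟩) (by omega)
    have hne : ∀ t ∈ T, iteratedDeriv (m t) (fun s => f s ω) t ≠ 0 :=
      fun t ht => (hord t ht).2.1.2
    obtain ⟨r, R, hr, hR, hI⟩ := exists_integral_eq_sum_stationaryTerm (hf ω) m T hm hlow hne
      (hφ ω) hgc fun t ht h0 => (hT t).mpr ⟨hsupp ω ht, h0⟩
    obtain ⟨t₁, ht₁⟩ := hTne
    -- The global remainder `R = O(1/k)` is charged to a single point `t₁`, which exists as `T` is
    -- nonempty; this is harmless because `2 / m ≤ 1`.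
    refine ⟨fun t k => r t k + if t = t₁ then R k else 0, fun t ht => ?_, fun k _ => ?_⟩
    · refine (hr t ht).add ?_
      split_ifs
      · exact hR.trans (isBigO_one_div_rpow (hm t ht))
      · exact isBigO_zero _ _
    · have he : ∀ t ∈ T.filter fun t => Even (m t),
          StationaryPhase.evenTerm φ f ω (m t) t k =
            stationaryTerm (fun s => f s ω) (m t) (φ t ω) t k := fun t ht => by
        rw [Finset.mem_filter] at ht
        exact StationaryPhase.evenTerm_eq φ f ω (hm t ht.1) ht.2 t k
      have ho : ∀ t ∈ T.filter fun t => Odd (m t),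
          StationaryPhase.oddTerm φ f ω (m t) t k =
            stationaryTerm (fun s => f s ω) (m t) (φ t ω) t k := fun t ht => by
        rw [Finset.mem_filter] at ht
        exact StationaryPhase.oddTerm_eq φ f ω (hm t ht.1) ht.2 t k (hne t ht.1)
      rw [Finset.sum_congr rfl fun t ht => by rw [he t ht],
        Finset.sum_congr (s₁ := T.filter fun t => Odd (m t)) rfl fun t ht => by rw [ho t ht]]
      simp only [← Nat.not_even_iff_odd]
      rw [Finset.sum_filter_add_sum_filter_not, StationaryPhase.highFreqIntegral, hI k]
      simp only [← add_assoc]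
      rw [Finset.sum_add_distrib (g := fun t => if t = t₁ then R k else 0),
        Finset.sum_ite_eq' T t₁, if_pos ht₁]
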